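/- Let $d\ge 1$ be an integer and let $K$ be a field of characteristic $0$ or of characteristic greater than $d$. Let $S_d$ act on functions $F:X^d\to K$ ($X$ any set) by $(\sigma F)(x_1,\dots,x_d)=F(x_{\sigma(1)},\dots,x_{\sigma(d)})$, and let the group algebra $K[S_d]$ act accordingly. For a representation $\rho:S_d\to \mathrm{Aut}(V)$ over $K$ let $\beta_V\in K[S_d]$ be the unique central idempotent such that, for all $a\in K[S_d]$, $a$ acts as zero on $V$ if and only if $\beta_V a=0$. For an $S_d$-invariant linear subspace $C^d(X,K)$ of the space of functions $X^d\to K$ put $W_V^d(X,K)=\beta_V\,C^d(X,K)$. Let $V_s$ be the trivial representation on $K$ and $V_J$ the standard representation of $S_d$ on the hyperplane $x_1+\dots+x_d=0$ of $K^d$. (1) For every set $X$, every such $C^d(X,K)$, every $F\in\bigoplus_{V\in \mathrm{Irr}(S_d)\setminus\{V_s,V_J\}}W_V^d(X,K)$ and all $x,y\in X$, $$F(y,x,\dots,x)=F(x,y,x,\dots,x)=\dots=F(x,\dots,x,y)=0.$$ (2) In particular, let $X$ be a finite-dimensional vector space over $K$ with basis $b_1,\dots,b_n$ and let $C^d(X,K)$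 be the space of $d$-linear forms on $X$. Then the hyperdeterminant of every $d$-linear form $F\in\bigoplus_{V\in \mathrm{Irr}(S_d)\setminus\{V_s,V_J\}}W_V^d(X,K)$ is zero. That is, $\Delta\big((F(b_{i_1},\dots,b_{i_d}))_{i_1,\dots,i_d}\big)=0$ for every hyperdeterminant $\Delta$ of format $n\times\dots\times n$ ($d$ factors). Here a hyperdeterminant (unique up to a nonzero constant if it exists) is an irreducible polynomial over $K$ in the entries of a $d$-dimensional matrix that generates the ideal of all polynomials vanishing on the dual variety of the Segre variety, i.e. at all matrices $a$ over the algebraic closure $\overline K$ for which there are nonzero vectors $x^{(1)},\dots,x^{(d)}\in\overline K^n$ such that the multilinear form $\sum a_{i_1\dots i_d}\,x^{(1)}_{i_1}\cdots x^{(d)}_{i_d}$ becomes zero whenever one of the $x^{(j)}$ is replaced by an arbitrary vector. -/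

import Mathlib

open scoped MonoidAlgebra

universe u v

noncomputable section

namespace SymmetryClasses

/-- `β` is the idempotent of `K[G]` attached to the representation `ρ`: a central idempotent such
that `K[G] = β K[G] ⊕ ker ρ̃`, where `ρ̃ : K[G] → End V` is the algebra map extending `ρ`. -/
structure IsIdempotentOf {K G V : Type*} [Field K] [Group G] [AddCommGroup V] [Module K V]
    (ρ : Representation K G V) (β : K[G]) : Prop where
  central : ∀ a : K[G], β * a = a * β
  idempotent : β * β = β
  ker_iff : ∀ a : K[G], ρ.asAlgebraHom a = 0 ↔ β * a = 0

/-- The idempotent attached to a representation exists and is unique when the characteristic of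
the field does not divide the order of the group. -/
theorem existsUnique_isIdempotentOf {K G V : Type*} [Field K] [Group G] [Finite G]
    [AddCommGroup V] [Module K V] (hG : (Nat.card G : K) ≠ 0) (ρ : Representation K G V) :
    ∃! β : K[G], IsIdempotentOf ρ β := by
  have : NeZero (Nat.card G : K) := ⟨hG⟩
  set I : Ideal K[G] := RingHom.ker ρ.asAlgebraHom with hI
  have mem : ∀ a, a ∈ I ↔ ρ.asAlgebraHom a = 0 := fun a => RingHom.mem_ker
  have hright : ∀ J : Ideal K[G], ∃ e ∈ J, ∀ a ∈ J, a * e = a := by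
    intro J
    obtain ⟨e, he, hJ⟩ := IsSemisimpleRing.ideal_eq_span_idempotent J
    refine ⟨e, hJ ▸ Ideal.mem_span_singleton_self e, fun a ha => ?_⟩
    rw [hJ, Ideal.mem_span_singleton'] at ha
    obtain ⟨b, rfl⟩ := ha
    rw [mul_assoc, he.eq]
  obtain ⟨e, heI, he⟩ := hright I
  have hmulr : ∀ a ∈ I, ∀ b, a * b ∈ I := fun a ha b => by
    rw [mem] at ha ⊢; rw [map_mul, ha, zero_mul]
  let N : Ideal K[G] :=
    { carrier := {z | z ∈ I ∧ ∀ b ∈ I, b * z = 0}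
      zero_mem' := ⟨I.zero_mem, fun b _ => mul_zero b⟩
      add_mem' := fun {x y} hx hy => ⟨I.add_mem hx.1 hy.1, fun b hb => by
        rw [mul_add, hx.2 b hb, hy.2 b hb, add_zero]⟩
      smul_mem' := fun c x hx => ⟨I.mul_mem_left c hx.1, fun b hb => by
        rw [smul_eq_mul, ← mul_assoc]; exact hx.2 _ (hmulr b hb c)⟩ }
  have hN : ∀ z, z ∈ I → (∀ b ∈ I, b * z = 0) → z = 0 := by
    intro z hz hz'
    obtain ⟨f, hfN, hf⟩ := hright N
    rw [← hf z ⟨hz, hz'⟩]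
    exact hfN.2 z hz
  have heleft : ∀ a ∈ I, e * a = a := by
    intro a ha
    refine (sub_eq_zero.mp (hN (a - e * a) (I.sub_mem ha (I.mul_mem_left e ha)) ?_)).symm
    intro b hb
    rw [mul_sub, ← mul_assoc, he b hb, sub_self]
  have hcen : ∀ a, e * a = a * e := fun a => by
    rw [← he (e * a) (hmulr e heI a), mul_assoc]
    exact heleft _ (I.mul_mem_left a heI)
  refine ⟨1 - e, ⟨fun a => ?_, ?_, fun a => ?_⟩, ?_⟩
  · rw [sub_mul, mul_sub, one_mul, mul_one, hcen]
  · rw [sub_mul, one_mul, mul_sub, mul_one, he e heI, sub_self, sub_zero]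
  · rw [← mem, sub_mul, one_mul, sub_eq_zero]
    exact ⟨fun h => (heleft a h).symm, fun h => h ▸ hmulr e heI a⟩
  · intro β hβ
    have h1 : β * e = 0 := (hβ.ker_iff e).1 ((mem e).1 heI)
    have h2 : 1 - β ∈ I := (mem _).2 ((hβ.ker_iff _).2 (by
      rw [mul_sub, mul_one, hβ.idempotent, sub_self]))
    have h3 := he _ h2
    rw [sub_mul, one_mul, h1, sub_zero] at h3
    rw [h3, sub_sub_cancel]

/-- The idempotent `β_V ∈ K[G]` attached to a representation `V` of a finite group `G`. -/
def idempotentOf {K G V : Type*} [Field K] [Group G] [Finite G] [AddCommGroup V] [Module K V]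
    (hG : (Nat.card G : K) ≠ 0) (ρ : Representation K G V) : K[G] :=
  (existsUnique_isIdempotentOf hG ρ).choose

theorem isIdempotentOf_idempotentOf {K G V : Type*} [Field K] [Group G] [Finite G]
    [AddCommGroup V] [Module K V] (hG : (Nat.card G : K) ≠ 0) (ρ : Representation K G V) :
    IsIdempotentOf ρ (idempotentOf hG ρ) :=
  (existsUnique_isIdempotentOf hG ρ).choose_spec.1

/-- If `K` has characteristic zero or greater than `d`, then the order of `S_d` is nonzero
in `K`. -/
theorem card_perm_ne_zero {K : Type*} [Field K] {d : ℕ}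
    (hK : ringChar K = 0 ∨ d < ringChar K) : (Nat.card (Equiv.Perm (Fin d)) : K) ≠ 0 := by
  rw [Nat.card_eq_fintype_card, Fintype.card_perm, Fintype.card_fin]
  intro h
  rw [ringChar.spec] at h
  rcases hK with h0 | hd
  · rw [h0, zero_dvd_iff] at h
    exact Nat.factorial_ne_zero d h
  · rcases CharP.char_is_prime_or_zero K (ringChar K) with hp | hp
    · exact absurd ((hp.dvd_factorial).1 h) (not_le.2 hd)
    · omega

/-- The action of `S_d` on functions of `d` variables:
`(σ F)(x_1, …, x_d) = F(x_{σ(1)}, …, x_{σ(d)})`. -/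
def functionRep (K : Type*) [Field K] (d : ℕ) (X : Type*) :
    Representation K (Equiv.Perm (Fin d)) ((Fin d → X) → K) where
  toFun σ :=
    { toFun := fun F x => F (fun i => x (σ i))
      map_add' := fun _ _ => rfl
      map_smul' := fun _ _ => rfl }
  map_one' := rfl
  map_mul' _ _ := rfl

/-- The natural representation of `S_d` on `K^d`, given by `σ e_i = e_{σ(i)}`. -/
def naturalRep (K : Type*) [Field K] (d : ℕ) :
    Representation K (Equiv.Perm (Fin d)) (Fin d → K) where
  toFun σ :=
    { toFun := fun x j => x (σ⁻¹ j)
      map_add' := fun _ _ => rfl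
      map_smul' := fun _ _ => rfl }
  map_one' := rfl
  map_mul' σ τ := by
    ext x j
    simp [mul_inv_rev]

/-- The hyperplane `x_1 + ⋯ + x_d = 0` of `K^d`, as a subrepresentation. -/
def standardSub (K : Type*) [Field K] (d : ℕ) : Subrepresentation (naturalRep K d) where
  toSubmodule :=
    { carrier := {x | ∑ i, x i = 0}
      zero_mem' := by simp
      add_mem' := fun {x y} hx hy => by
        simp only [Set.mem_ofPred_eq, Pi.add_apply, Finset.sum_add_distrib] at *
        rw [hx, hy, add_zero]
      smul_mem' := fun c x hx => by
        simp only [Set.mem_ofPred_eq, Pi.smul_apply, smul_eq_mul, ← Finset.mul_sum] at *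
        rw [hx, mul_zero] }
  apply_mem_toSubmodule σ x hx :=
    (Equiv.sum_comp (σ⁻¹ : Equiv.Perm (Fin d)) x).trans hx

/-- The standard representation `V_J` of `S_d`. -/
def standardRep (K : Type*) [Field K] (d : ℕ) :
    Representation K (Equiv.Perm (Fin d)) (standardSub K d).toSubmodule :=
  (standardSub K d).toRepresentation

/-- The symmetry class `W_V^d(X,K) = β_V C^d(X,K)`, for an `S_d`-invariant space `C = C^d(X,K)` of
functions of `d` variables and a representation `ρ` of `S_d` on `V`. -/
def symmetryClass {K : Type*} [Field K] {d : ℕ} (hK : ringChar K = 0 ∨ d < ringChar K)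
    {X : Type*} (C : Subrepresentation (functionRep K d X))
    {V : Type*} [AddCommGroup V] [Module K V] (ρ : Representation K (Equiv.Perm (Fin d)) V) :
    Submodule K ((Fin d → X) → K) :=
  C.toSubmodule.map
    ((functionRep K d X).asAlgebraHom (idempotentOf (card_perm_ne_zero hK) ρ))

/-- The sum of the symmetry classes `W_V^d(X,K)` over all irreducible representations `V` of `S_d`
over `K` which are isomorphic neither to the trivial nor to the standard representation.
(Every irreducible representation is isomorphic to one on a space in the universe of `K`;
isomorphic representations have the same symmetry class.) -/
def otherClasses {K : Type u} [Field K] {d : ℕ} (hK : ringChar K = 0 ∨ d < ringChar K)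
    {X : Type v} (C : Subrepresentation (functionRep K d X)) :
    Submodule K ((Fin d → X) → K) :=
  ⨆ (V : Type u) (_ : AddCommGroup V) (_ : Module K V)
    (ρ : Representation K (Equiv.Perm (Fin d)) V) (_ : ρ.IsIrreducible)
    (_ : ¬ Nonempty (ρ.Equiv (Representation.trivial K (Equiv.Perm (Fin d)) K)))
    (_ : ¬ Nonempty (ρ.Equiv (standardRep K d))),
    symmetryClass hK C ρ

/-- The `S_d`-invariant space of multilinear forms in `d` variables on a vector space `X`. -/
def multilinearForms (K : Type*) [Field K] (d : ℕ) (X : Type*) [AddCommGroup X] [Module K X] :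
    Subrepresentation (functionRep K d X) where
  toSubmodule :=
    { carrier := {F | ∃ f : MultilinearMap K (fun _ : Fin d => X) K, ⇑f = F}
      zero_mem' := ⟨0, rfl⟩
      add_mem' := by
        rintro _ _ ⟨f, rfl⟩ ⟨g, rfl⟩
        exact ⟨f + g, rfl⟩
      smul_mem' := by
        rintro c _ ⟨f, rfl⟩
        exact ⟨c • f, rfl⟩ }
  apply_mem_toSubmodule σ := by
    rintro _ ⟨f, rfl⟩
    exact ⟨f.domDomCongr σ, rfl⟩

/-- The multilinear form `∑ a_{i_1 … i_d} x^{(1)}_{i_1} ⋯ x^{(d)}_{i_d}` with coefficients `a`. -/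
def formOf {L : Type*} [Field L] {d n : ℕ} (a : (Fin d → Fin n) → L) (x : Fin d → Fin n → L) : L :=
  ∑ i : Fin d → Fin n, a i * ∏ j, x j (i j)

/-- A `d`-dimensional matrix of format `n × ⋯ × n` is degenerate if the hyperplane that it defines
contains the tangent space to the Segre variety at some point `x^{(1)} ⊗ ⋯ ⊗ x^{(d)}`; that tangent
space is spanned by the tensors obtained by replacing one of the factors by an arbitrary vector.
The degenerate matrices form the (cone over the) dual variety of the Segre variety. -/
def IsDegenerate {L : Type*} [Field L] {d n : ℕ} (a : (Fin d → Fin n) → L) : Prop :=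
  ∃ x : Fin d → Fin n → L, (∀ j, x j ≠ 0) ∧
    ∀ (j : Fin d) (y : Fin n → L), formOf a (Function.update x j y) = 0

/-- `Δ` is the hyperdeterminant of format `n × ⋯ × n` (`d` factors) over `K`, which is defined up
to a nonzero constant: the irreducible polynomial in the entries of a `d`-dimensional matrix that
generates the ideal of the dual variety of the Segre variety, i.e. the ideal of the polynomials
vanishing at all degenerate matrices over the algebraic closure of `K`. -/
def IsHyperdeterminant {K : Type*} [Field K] {d n : ℕ}
    (Δ : MvPolynomial (Fin d → Fin n) K) : Prop :=
  Irreducible Δ ∧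
    MvPolynomial.vanishingIdeal K
      {a : (Fin d → Fin n) → AlgebraicClosure K | IsDegenerate a} = Ideal.span {Δ}

end SymmetryClasses

end

noncomputable section

namespace SymmetryClasses

open Equiv (Perm)

/-! For fixed `x` and `y`, sending `F` to the vector of its values at the points with one entry `y`
and all others `x` is an equivariant map `nearDiagonal` into `K^d`, so it commutes with every `β_V`.
Since `d` is invertible, `K^d` is the sum of the constants and the standard hyperplane; hence it has
no nonzero map to any other irreducible `V`, and `β_V` kills it (`naturalRep_idempotent_eq_zero`).
This gives (1). For (2), apply (1) to basis vectors: the coefficient matrix vanishes near a diagonal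
position, so it is degenerate at the corresponding pure tensor, where every hyperdeterminant
vanishes. -/

/-- Intertwining maps commute with the action of the group algebra. -/
theorem map_asAlgebraHom {K G V W : Type*} [Field K] [Group G] [AddCommGroup V] [Module K V]
    [AddCommGroup W] [Module K W] {ρ : Representation K G V} {τ : Representation K G W}
    (f : ρ.IntertwiningMap τ) (a : K[G]) (v : V) :
    f (ρ.asAlgebraHom a v) = τ.asAlgebraHom a (f v) := by
  induction a using MonoidAlgebra.induction_linear with
  | zero => simp
  | add a b ha hb => simp [ha, hb]
  | single g r => simp [f.isIntertwining]

/-! ### Invariant subspaces of `K^d` and maps from it to irreducible representations -/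

theorem natCast_dim_ne_zero {K : Type*} [Field K] {d : ℕ} (hd : 0 < d)
    (hK : ringChar K = 0 ∨ d < ringChar K) : (d : K) ≠ 0 := by
  intro h
  rw [ringChar.spec] at h
  rcases hK with h0 | h1
  · rw [h0, zero_dvd_iff] at h
    omega
  · exact absurd (Nat.le_of_dvd hd h) (not_le.2 h1)

theorem naturalRep_single {K : Type*} [Field K] {d : ℕ} (σ : Perm (Fin d)) (i : Fin d) (c : K) :
    naturalRep K d σ (Pi.single i c) = Pi.single (σ i) c := by
  ext j
  change (Pi.single i c : Fin d → K) (σ⁻¹ j) = _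
  simp only [Pi.single_apply, Equiv.Perm.inv_eq_iff_eq]

/-- An invariant subspace of `K^d` containing a nonconstant vector contains all differences of
basis vectors. -/
theorem single_sub_single_mem {K : Type*} [Field K] {d : ℕ}
    (P : Subrepresentation (naturalRep K d)) {x : Fin d → K} (hx : x ∈ P.toSubmodule)
    {i j : Fin d} (hij : x i ≠ x j) (k l : Fin d) :
    (Pi.single k 1 - Pi.single l 1 : Fin d → K) ∈ P.toSubmodule := by
  have hne : i ≠ j := fun h => hij (by rw [h])
  have h1 : (Pi.single i 1 - Pi.single j 1 : Fin d → K) ∈ P.toSubmodule := by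
    have h : x - naturalRep K d (Equiv.swap i j) x =
        (x i - x j) • (Pi.single i 1 - Pi.single j 1 : Fin d → K) := by
      ext m
      change x m - x ((Equiv.swap i j)⁻¹ m) = _
      rw [Equiv.swap_inv]
      by_cases hmi : m = i
      · subst hmi; simp [hne]
      by_cases hmj : m = j
      · subst hmj; simp [hne.symm]
      · simp [Equiv.swap_apply_of_ne_of_ne hmi hmj, hmi, hmj]
    rw [← Submodule.smul_mem_iff _ (sub_ne_zero.2 hij), ← h]
    exact P.toSubmodule.sub_mem hx (P.apply_mem_toSubmodule _ hx)
  rcases eq_or_ne k l with rfl | hkl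
  · simp
  -- The first swap takes `i` to `k`; the second takes the image of `j` to `l` and fixes `k`, which
  -- differs from both.
  have h2 := P.apply_mem_toSubmodule
    (Equiv.swap (Equiv.swap i k j) l * Equiv.swap i k) h1
  rw [map_sub, naturalRep_single, naturalRep_single] at h2
  have hk : (Equiv.swap (Equiv.swap i k j) l * Equiv.swap i k) i = k := by
    rw [Equiv.Perm.mul_apply, Equiv.swap_apply_left]
    refine Equiv.swap_apply_of_ne_of_ne (fun h => hne ?_) hkl
    rw [← Equiv.swap_apply_left i k] at h
    exact (Equiv.swap i k).injective (by simpa using h)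
  have hl : (Equiv.swap (Equiv.swap i k j) l * Equiv.swap i k) j = l := by
    rw [Equiv.Perm.mul_apply, Equiv.swap_apply_left]
  rwa [hk, hl] at h2

/-- An invariant subspace of `K^d` containing a nonconstant vector contains the hyperplane
`x_1 + ⋯ + x_d = 0`. -/
theorem standardSub_le {K : Type*} [Field K] {d : ℕ}
    (P : Subrepresentation (naturalRep K d)) {x : Fin d → K} (hx : x ∈ P.toSubmodule)
    {i j : Fin d} (hij : x i ≠ x j) {y : Fin d → K} (hy : ∑ k, y k = 0) :
    y ∈ P.toSubmodule := by
  have h : y = ∑ k, y k • (Pi.single k 1 - Pi.single i 1 : Fin d → K) := by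
    simp only [smul_sub, Finset.sum_sub_distrib, ← Finset.sum_smul, hy, zero_smul, sub_zero]
    exact pi_eq_sum_univ' y |>.trans (by simp)
  rw [h]
  exact Submodule.sum_mem _ fun k _ =>
    P.toSubmodule.smul_mem _ (single_sub_single_mem P hx hij k i)

/-- Every map from the natural representation to an irreducible representation that is neither
trivial nor standard vanishes. -/
theorem intertwiningMap_naturalRep_eq_zero {K V : Type*} [Field K] [AddCommGroup V] [Module K V]
    {d : ℕ} (hd : (d : K) ≠ 0) {ρ : Representation K (Perm (Fin d)) V} [ρ.IsIrreducible]
    (h1 : ¬ Nonempty (ρ.Equiv (Representation.trivial K (Perm (Fin d)) K)))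
    (h2 : ¬ Nonempty (ρ.Equiv (standardRep K d)))
    (T : (naturalRep K d).IntertwiningMap ρ) (x : Fin d → K) : T x = 0 := by
  have hconst : T (fun _ => 1) = 0 := by
    by_contra hw
    let f : (Representation.trivial K (Perm (Fin d)) K).IntertwiningMap ρ :=
      { toLinearMap := LinearMap.toSpanSingleton K V (T fun _ => 1)
        isIntertwining' := fun g => by
          ext
          simp only [LinearMap.comp_apply, LinearMap.toSpanSingleton_apply,
            Representation.isTrivial_def, LinearMap.id_apply, one_smul]
          rw [← T.isIntertwining]
          rfl }
    have hf : ∀ c, f c = c • T (fun _ => 1) := fun _ => rfl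
    -- A nonzero map from a line is injective, and irreducibility of the target makes it surjective.
    refine h1 ⟨(f.ofBijective ⟨?_, ?_⟩).symm⟩
    · intro a b hab
      rw [hf, hf] at hab
      exact smul_left_injective K hw hab
    · refine (Representation.IsIrreducible.surjective_or_eq_zero f).resolve_right fun h0 => hw ?_
      have := hf 1
      rwa [h0, one_smul, eq_comm] at this
  have hstd : ∀ y : Fin d → K, ∑ k, y k = 0 → T y = 0 := by
    let f : (standardRep K d).IntertwiningMap ρ :=
      { toLinearMap := T.toLinearMap ∘ₗ (standardSub K d).toSubmodule.subtype
        isIntertwining' := fun g => by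
          ext y
          exact T.isIntertwining _ _ g y.1 }
    have hf : ∀ y, f y = T y.1 := fun _ => rfl
    by_contra! hne
    obtain ⟨y, hy, hTy⟩ := hne
    refine h2 ⟨(f.ofBijective ⟨?_, ?_⟩).symm⟩
    · rw [injective_iff_map_eq_zero]
      intro z hz
      rw [hf] at hz
      by_contra hz0
      -- A nonconstant vector in the invariant subspace `T.ker` would force the whole hyperplane,
      -- including `y`, into it. A constant vector with sum zero is zero because `d` is invertible.
      have hcst : ∀ i j, z.1 i = z.1 j := fun i j => by
        by_contra hij
        exact hTy (standardSub_le T.ker (x := z.1) hz hij hy)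
      refine hz0 (Subtype.ext (funext fun i => ?_))
      have hsum : ∑ k, z.1 k = 0 := z.2
      rw [Finset.sum_congr rfl fun k _ => hcst k i] at hsum
      simpa [hd] using hsum
    · refine (Representation.IsIrreducible.surjective_or_eq_zero f).resolve_right fun h0 => hTy ?_
      have := hf ⟨y, hy⟩
      rwa [h0, eq_comm] at this
  have hx : x = (fun k => x k - (∑ i, x i) / d) + ((∑ i, x i) / d) • (fun _ => (1 : K)) := by
    ext k; simp
  rw [hx, map_add, map_smul, hconst, hstd, smul_zero, add_zero]
  simp [Finset.sum_sub_distrib, mul_div_cancel₀ _ hd]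

/-! ### Annihilation of `K^d` by the other idempotents -/

/-- The number of permutations that send `i` to `j` is nonzero in `K`. -/
theorem card_filter_apply_eq_ne_zero {K : Type*} [Field K] {d : ℕ}
    (hK : ringChar K = 0 ∨ d < ringChar K) (i j : Fin d) :
    ((Finset.univ.filter fun g : Perm (Fin d) => g i = j).card : K) ≠ 0 := by
  have hN : ∀ k, (Finset.univ.filter fun g : Perm (Fin d) => g i = k).card =
      (Finset.univ.filter fun g : Perm (Fin d) => g i = j).card := fun k =>
    Finset.card_equiv (Equiv.mulLeft (Equiv.swap k j)) fun g => by
      simp [Equiv.swap_apply_eq_iff]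
  have hsum := Finset.card_eq_sum_card_fiberwise (s := (Finset.univ : Finset (Perm (Fin d))))
    (f := fun g => g i) (t := Finset.univ) fun _ _ => by simp
  -- The `d` fibres have equal size, so that size divides `d!`, which is nonzero in `K`.
  rw [Finset.sum_congr rfl fun k _ => hN k] at hsum
  intro h
  apply card_perm_ne_zero (K := K) (d := d) hK
  rw [Nat.card_eq_fintype_card, ← Finset.card_univ, hsum]
  simp [h]

/-- The map `x ↦ ∑ g, x (g i) • g v` from the natural representation to `V`. -/
def orbitMap {K V : Type*} [Field K] [AddCommGroup V] [Module K V] {d : ℕ}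
    (ρ : Representation K (Perm (Fin d)) V) (i : Fin d) (v : V) :
    (naturalRep K d).IntertwiningMap ρ where
  toFun x := ∑ g, x (g i) • ρ g v
  map_add' x y := by simp [add_smul, Finset.sum_add_distrib]
  map_smul' c x := by simp [mul_smul, Finset.smul_sum]
  isIntertwining' σ := by
    refine LinearMap.ext fun x => ?_
    change ∑ g : Perm (Fin d), x (σ⁻¹ (g i)) • ρ g v = ρ σ (∑ g, x (g i) • ρ g v)
    rw [map_sum, ← Equiv.sum_comp (Equiv.mulLeft σ)]
    simp

/-- The idempotent of an irreducible representation that is neither trivial nor standard acts as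
zero on the natural representation. -/
theorem naturalRep_idempotent_eq_zero {K V : Type*} [Field K] [AddCommGroup V] [Module K V]
    {d : ℕ} (hd : 0 < d) (hK : ringChar K = 0 ∨ d < ringChar K)
    {ρ : Representation K (Perm (Fin d)) V} [ρ.IsIrreducible]
    (h1 : ¬ Nonempty (ρ.Equiv (Representation.trivial K (Perm (Fin d)) K)))
    (h2 : ¬ Nonempty (ρ.Equiv (standardRep K d))) {β : K[Perm (Fin d)]}
    (hβ : IsIdempotentOf ρ β) : (naturalRep K d).asAlgebraHom β = 0 := by
  let i : Fin d := ⟨0, hd⟩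
  refine LinearMap.pi_ext' fun k => LinearMap.ext_ring ?_
  -- `a` is the sum of all `g` with `g i = k`. On `V` it acts by `v ↦ orbitMap ρ i v e_k = 0`, so `β
  -- * a = 0`; on `K^d` it sends `e_i` to a nonzero multiple of `e_k`. Hence `β` kills `e_k`.
  let a : K[Perm (Fin d)] := ∑ g : Perm (Fin d),
    MonoidAlgebra.single g ((Pi.single k 1 : Fin d → K) (g i))
  have ha : ρ.asAlgebraHom a = 0 := by
    ext v
    have h := intertwiningMap_naturalRep_eq_zero (natCast_dim_ne_zero hd hK) h1 h2
      (orbitMap ρ i v) (Pi.single k 1)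
    simp only [a, map_sum, Representation.asAlgebraHom_single, LinearMap.sum_apply,
      LinearMap.smul_apply, LinearMap.zero_apply]
    exact h
  have hact : (naturalRep K d).asAlgebraHom a (Pi.single i 1) =
      ((Finset.univ.filter fun g : Perm (Fin d) => g i = k).card : K) •
        (Pi.single k 1 : Fin d → K) := by
    simp only [a, map_sum, Representation.asAlgebraHom_single, LinearMap.sum_apply,
      LinearMap.smul_apply, naturalRep_single]
    rw [Finset.card_filter, Nat.cast_sum, Finset.sum_smul]
    refine Finset.sum_congr rfl fun g _ => ?_
    by_cases hg : g i = k
    · simp [hg]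
    · simp [hg]
  have hzero : (naturalRep K d).asAlgebraHom (β * a) (Pi.single i 1) = 0 := by
    rw [(hβ.ker_iff a).1 ha, map_zero, LinearMap.zero_apply]
  rw [map_mul, Module.End.mul_apply, hact, map_smul] at hzero
  exact (smul_eq_zero.1 hzero).resolve_left (card_filter_apply_eq_ne_zero hK i k)

/-! ### Values near the diagonal -/

/-- The map that sends `F` to the vector of the values `F(x, …, x, y, x, …, x)`. -/
def nearDiagonal (K : Type*) [Field K] (d : ℕ) {X : Type*} (x y : X) :
    (functionRep K d X).IntertwiningMap (naturalRep K d) where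
  toFun F j := F (Function.update (fun _ => x) j y)
  map_add' _ _ := rfl
  map_smul' _ _ := rfl
  isIntertwining' σ := by
    refine LinearMap.ext fun F => funext fun j => ?_
    change F (fun m => Function.update (fun _ => x) j y (σ m)) =
      F (Function.update (fun _ => x) (σ⁻¹ j) y)
    congr 1
    ext m
    simp only [Function.update_apply, Equiv.Perm.eq_inv_iff_eq]

theorem apply_update_eq_zero {K : Type u} [Field K] {d : ℕ} (hd : 0 < d)
    (hK : ringChar K = 0 ∨ d < ringChar K) {X : Type v}
    (C : Subrepresentation (functionRep K d X)) {F : (Fin d → X) → K}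
    (hF : F ∈ otherClasses hK C) (x y : X) (j : Fin d) :
    F (Function.update (fun _ => x) j y) = 0 := by
  have hle : otherClasses hK C ≤ LinearMap.ker (nearDiagonal K d x y).toLinearMap := by
    simp only [otherClasses, iSup_le_iff]
    rintro V _ _ ρ hρ h1 h2 _ ⟨F, -, rfl⟩
    rw [LinearMap.mem_ker, Representation.IntertwiningMap.toLinearMap_apply, map_asAlgebraHom,
      naturalRep_idempotent_eq_zero hd hK h1 h2 (isIdempotentOf_idempotentOf _ ρ),
      LinearMap.zero_apply]
  exact congrFun (LinearMap.mem_ker.1 (hle hF)) j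

/-! ### Degenerate matrices and hyperdeterminants -/

/-- A matrix whose entries vanish at all positions differing from `(m, …, m)` in at most one
place is degenerate. -/
theorem isDegenerate_of_forall_update {L : Type*} [Field L] {d n : ℕ}
    {a : (Fin d → Fin n) → L} (m : Fin n)
    (ha : ∀ j k, a (Function.update (fun _ => m) j k) = 0) : IsDegenerate a := by
  -- At the point `e_m ⊗ ⋯ ⊗ e_m` with factor `j` replaced, only indices equal to `m` away from `j`
  -- contribute, and there `a` vanishes.
  refine ⟨fun _ => Pi.single m 1, fun _ => by simp, fun j y => ?_⟩
  refine Finset.sum_eq_zero fun i _ => ?_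
  by_cases h : ∀ l, l ≠ j → i l = m
  · have hi : i = Function.update (fun _ => m) j (i j) := by
      ext l
      by_cases hl : l = j
      · subst hl; simp
      · simp [hl, h l hl]
    rw [hi, ha, zero_mul]
  · push Not at h
    obtain ⟨l, hl, hil⟩ := h
    rw [Finset.prod_eq_zero (Finset.mem_univ l), mul_zero]
    rw [Function.update_of_ne hl, Pi.single_eq_of_ne hil]

theorem IsHyperdeterminant.eval_eq_zero {K : Type*} [Field K] {d n : ℕ}
    {Δ : MvPolynomial (Fin d → Fin n) K} (hΔ : IsHyperdeterminant Δ) {a : (Fin d → Fin n) → K}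
    (ha : IsDegenerate fun i => algebraMap K (AlgebraicClosure K) (a i)) :
    MvPolynomial.eval a Δ = 0 := by
  have hmem : Δ ∈ MvPolynomial.vanishingIdeal K
      {a : (Fin d → Fin n) → AlgebraicClosure K | IsDegenerate a} :=
    hΔ.2 ▸ Ideal.mem_span_singleton_self Δ
  have h := MvPolynomial.mem_vanishingIdeal_iff.1 hmem _ ha
  apply (algebraMap K (AlgebraicClosure K)).injective
  rw [map_zero, ← h, ← MvPolynomial.coe_aeval_eq_eval]
  exact (MvPolynomial.aeval_algebraMap_apply (AlgebraicClosure K) a Δ).symm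

/-- There is no hyperdeterminant without matrix entries. -/
theorem not_isHyperdeterminant_of_isEmpty {K : Type*} [Field K] {d n : ℕ}
    [IsEmpty (Fin d → Fin n)] (Δ : MvPolynomial (Fin d → Fin n) K) : ¬ IsHyperdeterminant Δ := by
  intro h
  obtain ⟨c, rfl⟩ := MvPolynomial.C_surjective (Fin d → Fin n) Δ
  have hc : c ≠ 0 := fun h0 => h.1.ne_zero (by rw [h0, map_zero])
  exact h.1.not_isUnit ((isUnit_iff_ne_zero.2 hc).map MvPolynomial.C)

end SymmetryClasses

end

theorem proposition4p11 {K : Type u} [Field K] {d : ℕ} (hd : 0 < d)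
    (hK : ringChar K = 0 ∨ d < ringChar K) :
    (∀ (X : Type v) (C : Subrepresentation (SymmetryClasses.functionRep K d X)),
      ∀ F ∈ SymmetryClasses.otherClasses hK C, ∀ (x y : X) (j : Fin d),
        F (Function.update (fun _ => x) j y) = 0) ∧
    (∀ (X : Type v) [AddCommGroup X] [Module K X] (n : ℕ) (b : Module.Basis (Fin n) K X)
      (F : MultilinearMap K (fun _ : Fin d => X) K),
      ⇑F ∈ SymmetryClasses.otherClasses hK (SymmetryClasses.multilinearForms K d X) →
      ∀ Δ : MvPolynomial (Fin d → Fin n) K, SymmetryClasses.IsHyperdeterminant Δ →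
        MvPolynomial.eval (fun i : Fin d → Fin n => F (fun j => b (i j))) Δ = 0) := by
  refine ⟨fun X C F hF => SymmetryClasses.apply_update_eq_zero hd hK C hF, ?_⟩
  intro X _ _ n b F hF Δ hΔ
  -- For `n = 0` there is no basis vector to serve as `x`, but then `Δ` is a constant and cannot be
  -- irreducible.
  rcases n with _ | n
  · have : Nonempty (Fin d) := ⟨⟨0, hd⟩⟩
    exact absurd hΔ (SymmetryClasses.not_isHyperdeterminant_of_isEmpty Δ)
  refine hΔ.eval_eq_zero (SymmetryClasses.isDegenerate_of_forall_update 0 fun j k => ?_)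
  have h : (fun l => b (Function.update (fun _ => (0 : Fin (n + 1))) j k l)) =
      Function.update (fun _ => b 0) j (b k) := by
    ext l
    by_cases hl : l = j
    · subst hl; simp
    · simp [hl]
  rw [h, SymmetryClasses.apply_update_eq_zero hd hK _ hF, map_zero]
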